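/- Let $V$ be a vector space of finite dimension $n\ge 1$ over a finite field $F$; write $X^g=g^{-1}Xg$. An element of $\mathrm{GL}(V)$ is called semisimple if its order is coprime to the characteristic of $F$. (1) Let $|F|=q^2$, let $\beta$ be a non-degenerate hermitian form on $V$ (with respect to $\lambda\mapsto\lambda^q$), let $\mathrm U(n,q)\le\mathrm{GL}(V)$ be its isometry group, and let $\mathrm{SU}(n,q)$ be the subgroup of elements of determinant $1$. For every semisimple $X\in\mathrm{SU}(n,q)$, the conjugacy class of $X$ in $\mathrm{SU}(n,q)$ coincides with the conjugacy class of $X$ in $\mathrm U(n,q)$. Equivalently, two semisimple elements of $\mathrm{SU}(n,q)$ are conjugate in $\mathrm{SU}(n,q)$ if, and only if, they are conjugate in $\mathrm U(n,q)$. (2) Let $|F|=q$ be odd, let $Q$ be a non-singular quadratic form on $V$ (that is, its associated bilinear form $Q(u+v)-Q(u)-Q(v)$ is non-degenerate; $Q$ may be of any type $\epsilon\in\{+,-,\circ\}$), let $\mathrm O^\epsilon(n,q)\le\mathrm{GL}(V)$ be its isometry group, and let $\mathrm{SO}^\epsilon(n,q)$ be the subgroup of elements of determinant $1$. Let $X\in\mathrm{SO}^\epsilon(n,q)$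 be semisimple. - If $X^2-1$ is singular, then the conjugacy class of $X$ in $\mathrm{SO}^\epsilon(n,q)$ coincides with the conjugacy class of $X$ in $\mathrm O^\epsilon(n,q)$. - If $X^2-1$ is non-singular, then the conjugacy class of $X$ in $\mathrm O^\epsilon(n,q)$ is the union of two distinct (hence disjoint) conjugacy classes of $\mathrm{SO}^\epsilon(n,q)$, with representatives $X$ and $X^Z$, where $Z$ is any element of $\mathrm O^\epsilon(n,q)$ with $\det Z=-1$; such elements $Z$ exist. -/

import Mathlib

namespace ClassicalGroups

theorem add_pow_of_card_eq_sq {F : Type*} [Field F] [Finite F] {q : ℕ}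
    (hq : Nat.card F = q ^ 2) (a b : F) : (a + b) ^ q = a ^ q + b ^ q := by
  have := Fintype.ofFinite F
  obtain ⟨p, hp⟩ := CharP.exists F
  obtain ⟨n, hpp, hn⟩ := FiniteField.card F p
  have : Fact p.Prime := ⟨hpp⟩
  have h1 : q ∣ p ^ (n : ℕ) := by
    rw [← hn, ← Nat.card_eq_fintype_card, hq]
    exact dvd_pow_self q two_ne_zero
  obtain ⟨m, -, rfl⟩ := (Nat.dvd_prime_pow hpp).1 h1
  exact add_pow_char_pow a b p m

/-- The automorphism `a ↦ a ^ q` of a finite field with `q ^ 2` elements. -/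
def bar {F : Type*} [Field F] [Finite F] {q : ℕ} (hq : Nat.card F = q ^ 2) : F →+* F where
  toFun a := a ^ q
  map_one' := one_pow q
  map_mul' a b := mul_pow a b q
  map_zero' := by
    refine zero_pow ?_
    rintro rfl
    exact Nat.card_pos.ne' hq
  map_add' := add_pow_of_card_eq_sq hq

section Groups

variable {F V : Type*} [Field F] [AddCommGroup V] [Module F V]

/-- The isometry group of a sesquilinear form, as a subgroup of the general linear group of `V`.
For `σ = bar hq` and a non-degenerate hermitian form this is the unitary group `U(n,q)`. -/
def unitaryGroup {σ : F →+* F} (β : V →ₛₗ[σ] V →ₗ[F] F) : Subgroup (V ≃ₗ[F] V) where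
  carrier := {X | ∀ u v, β (X u) (X v) = β u v}
  one_mem' _ _ := rfl
  mul_mem' {X Y} hX hY u v := (hX (Y u) (Y v)).trans (hY u v)
  inv_mem' {X} hX u v := by
    have h := hX (X⁻¹ u) (X⁻¹ v)
    rw [← LinearEquiv.mul_apply, ← LinearEquiv.mul_apply, mul_inv_cancel] at h
    exact h.symm

/-- The isometry group `O(V,Q)` of a quadratic form. -/
def orthogonalGroup (Q : QuadraticForm F V) : Subgroup (V ≃ₗ[F] V) where
  carrier := {X | ∀ v, Q (X v) = Q v}
  one_mem' _ := rfl
  mul_mem' {X Y} hX hY v := (hX (Y v)).trans (hY v)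
  inv_mem' {X} hX v := by
    have h := hX (X⁻¹ v)
    rw [← LinearEquiv.mul_apply, mul_inv_cancel] at h
    exact h.symm

/-- The elements of determinant `1` of a subgroup of the general linear group: `SU` or `SO`
when `C` is the unitary or the orthogonal group. -/
noncomputable def special (C : Subgroup (V ≃ₗ[F] V)) : Subgroup (V ≃ₗ[F] V) :=
  C ⊓ (LinearEquiv.det : (V ≃ₗ[F] V) →* Fˣ).ker

/-- `X` is semisimple if its order is coprime to the characteristic of `F`. -/
def IsSemisimpleElement (X : V ≃ₗ[F] V) : Prop :=
  (orderOf X).Coprime (ringChar F)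

end Groups

/-- The conjugacy class `x^H = {h⁻¹xh : h ∈ H}`. -/
def conjClass {G : Type*} [Group G] (H : Subgroup G) (x : G) : Set G :=
  {y | ∃ h ∈ H, y = h⁻¹ * x * h}

end ClassicalGroups

open ClassicalGroups

/-! Conjugation by `g` equals conjugation by `u⁻¹ * g` when `u` centralizes `X`. So the question is
which determinants occur on the centralizer of `X` in the full isometry group.

Unitary case. A determinant `c` satisfies `c * c ^ q = 1`, so `c = a / a ^ q` by Hilbert 90.
Semisimplicity yields minimal invariant subspaces `W`, `W'` in duality under `β`. The algebra `F[X]`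
acts on `W` as a finite field over which `W` is a line, so surjectivity of the norm gives `p` with
`p(X)` of determinant `a` on `W`. Let `w` be `p(X)` on `W` and the identity on the orthogonal of
`W'`. Its adjoint `w'` commutes with `w` and has determinant `a ^ q`, so `w'⁻¹ * w` is an isometry
of determinant `c` centralizing `X` (`exists_commute_det_mul_eq`).

Orthogonal case. If `X ^ 2 - 1` is singular, an eigenspace for `1` or `-1` is non-zero and
non-degenerate, and reflection in a non-isotropic eigenvector centralizes `X`. If it is invertible,
`X - X⁻¹` is invertible and skew-adjoint. For `h` of `2`-power order centralizing `X` it defines a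
non-degenerate alternating form on the `-1`-eigenspace of `h`, whose dimension is thus even, so `det
h = 1`. `det_eq_one_of_pow_two_pow` replaces this count by a single operator `T` with adjoint `T *
h⁻¹`. -/

namespace ClassicalGroups

open Module Module.End Polynomial

/-! ### Adjoints, and determinants of polynomials in an irreducible endomorphism -/

section Linear

variable {F V : Type*} [Field F] [AddCommGroup V] [Module F V] [FiniteDimensional F V]

/-- Adjoint endomorphisms for a non-degenerate sesquilinear form have conjugate determinants. -/
theorem det_eq_of_adjoint {σ : F →+* F} {β : V →ₛₗ[σ] V →ₗ[F] F} (hβ : β.SeparatingRight)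
    {T T' : End F V} (h : ∀ u v, β (T u) v = β u (T' v)) :
    LinearMap.det T' = σ (LinearMap.det T) := by
  classical
  let b := finBasis F V
  let J : Matrix _ _ F := Matrix.of fun i j ↦ β (b i) (b j)
  have hJ : J.det ≠ 0 := by
    intro h0
    obtain ⟨x, hx, hJx⟩ := Matrix.exists_mulVec_eq_zero_iff.2 h0
    apply hx
    have hz : ∑ j, x j • b j = 0 := by
      refine hβ _ fun y ↦ ?_
      have h1 (i) : β (b i) (∑ j, x j • b j) = 0 := by
        simpa [Matrix.mulVec, dotProduct, J, mul_comm] using congrFun hJx i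
      generalize ∑ j, x j • b j = z at h1 ⊢
      rw [← b.sum_repr y, map_sum, LinearMap.sum_apply]
      refine Finset.sum_eq_zero fun i _ ↦ ?_
      rw [LinearMap.map_smulₛₗ, LinearMap.smul_apply, h1, smul_zero]
    exact funext fun j ↦ Fintype.linearIndependent_iff.1 b.linearIndependent x hz j
  -- Adjointness in terms of the Gram matrix `J`; taking determinants cancels `det J`.
  have key : ((LinearMap.toMatrix b b T).map σ).transpose * J = J * LinearMap.toMatrix b b T' := by
    ext i j
    have := h (b i) (b j)
    rw [← b.sum_repr (T (b i)), ← b.sum_repr (T' (b j))] at this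
    simp only [map_sum, LinearMap.sum_apply, LinearMap.map_smulₛₗ, LinearMap.smul_apply,
      RingHom.id_apply, smul_eq_mul] at this
    simpa [Matrix.mul_apply, J, LinearMap.toMatrix_apply, mul_comm] using this
  have := congrArg Matrix.det key
  rw [Matrix.det_mul, Matrix.det_mul, Matrix.det_transpose, mul_comm, mul_right_inj' hJ,
    LinearMap.det_toMatrix] at this
  rw [← this, ← LinearMap.det_toMatrix b T, RingHom.map_det, RingHom.mapMatrix_apply]

/-- A minimal non-zero invariant subspace of an endomorphism. -/
def IsMinimalInvariant (f : End F V) (W : Submodule F V) : Prop :=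
  W ≠ ⊥ ∧ W ∈ f.invtSubmodule ∧ ∀ U ≤ W, U ∈ f.invtSubmodule → U = ⊥ ∨ U = W

theorem exists_isMinimalInvariant_le {f : End F V} {U : Submodule F V} (hU : U ≠ ⊥)
    (hf : U ∈ f.invtSubmodule) : ∃ W ≤ U, IsMinimalInvariant f W := by
  obtain ⟨W, ⟨hWU, hW0, hWf⟩, hmin⟩ := WellFounded.has_min (wellFounded_lt (α := Submodule F V))
    {W | W ≤ U ∧ W ≠ ⊥ ∧ W ∈ f.invtSubmodule} ⟨U, le_rfl, hU, hf⟩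
  refine ⟨W, hWU, hW0, hWf, fun U' hU' hf' ↦ ?_⟩
  by_contra! hc
  exact hmin U' ⟨hU'.trans hWU, hc.1, hf'⟩ (lt_of_le_of_ne hU' hc.2)

/-- If `f` has no proper non-zero invariant subspace, every scalar of a finite field is the
determinant of a polynomial in `f`. -/
theorem exists_det_aeval_eq [Finite F] [Nontrivial V] {f : End F V}
    (hf : ∀ U ∈ f.invtSubmodule, U = ⊥ ∨ U = ⊤) (a : F) :
    ∃ p : F[X], LinearMap.det (aeval f p) = a := by
  have : Finite V := Module.finite_of_finite F
  have : Finite (End F V) := Module.finite_of_finite F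
  let A := Algebra.adjoin F {f}
  have hcomm : ∀ k : A, Commute f k := fun k ↦ by
    obtain ⟨p, hp⟩ := Algebra.adjoin_mem_exists_aeval F f k.2
    rw [← hp]
    simpa using (Polynomial.commute_X p).map (aeval f)
  -- Schur's lemma: kernels of elements of `A` are `f`-invariant. Hence `A` is a finite commutative
  -- domain, that is, a field.
  have hinj : ∀ k : A, k ≠ 0 → LinearMap.ker (k : End F V) = ⊥ := fun k hk ↦ by
    refine (hf _ fun x hx ↦ ?_).resolve_right fun h ↦ hk ?_
    · rw [LinearMap.mem_ker] at hx
      have := LinearMap.congr_fun (hcomm k).eq x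
      simp only [End.mul_apply, hx, map_zero] at this
      exact this.symm
    · exact Subtype.ext (LinearMap.ker_eq_top.1 h)
  have : IsMulCommutative A := Algebra.isMulCommutative_adjoin F (by simp)
  have : NoZeroDivisors A := ⟨fun {x y} hxy ↦ by
    by_contra! hc
    obtain ⟨v, hv⟩ := exists_ne (0 : V)
    have h1 : (x : End F V) ((y : End F V) v) = 0 :=
      LinearMap.congr_fun (congrArg Subtype.val hxy) v
    have h2 := LinearMap.ker_eq_bot'.1 (hinj x hc.1) _ h1
    exact hv (LinearMap.ker_eq_bot'.1 (hinj y hc.2) _ h2)⟩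
  have : IsDomain A := NoZeroDivisors.to_isDomain A
  let _ : Field A := (Finite.isField_of_domain A).toField
  obtain ⟨v, hv⟩ := exists_ne (0 : V)
  -- Evaluation at `v ≠ 0` identifies `V` with `A` and the action of `k` with multiplication by `k`,
  -- so `det k` is the norm of `k`.
  let φ : A →ₗ[F] V := (LinearMap.applyₗ v).comp A.val.toLinearMap
  have hφ (k : A) : φ k = (k : End F V) v := rfl
  have hφi : Function.Injective φ := by
    rw [← LinearMap.ker_eq_bot, LinearMap.ker_eq_bot']
    intro k hk
    by_contra hk0
    exact hv (LinearMap.ker_eq_bot'.1 (hinj k hk0) v hk)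
  have hφs : Function.Surjective φ := by
    rw [← LinearMap.range_eq_top]
    refine (hf _ ?_).resolve_left fun h ↦ hv ?_
    · rintro _ ⟨k, rfl⟩
      exact ⟨⟨f, Algebra.self_mem_adjoin_singleton F f⟩ * k, rfl⟩
    · have : φ 1 ∈ LinearMap.range φ := ⟨1, rfl⟩
      rw [h] at this
      exact this
  let e : A ≃ₗ[F] V := LinearEquiv.ofBijective φ ⟨hφi, hφs⟩
  obtain ⟨k, hk⟩ := FiniteField.norm_surjective F A a
  obtain ⟨p, hp⟩ := Algebra.adjoin_mem_exists_aeval F f k.2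
  refine ⟨p, ?_⟩
  rw [hp, ← hk, Algebra.norm_apply, ← LinearMap.det_conj _ e]
  congr 1
  refine LinearMap.ext fun x ↦ ?_
  obtain ⟨y, rfl⟩ := e.surjective x
  simp only [LinearMap.comp_apply, LinearEquiv.coe_coe, e.symm_apply_apply]
  rfl

end Linear

end ClassicalGroups

namespace ClassicalGroups

open Module Module.End Polynomial

/-! ### Semisimple isometries and dual pairs of invariant subspaces -/

section Unitary

variable {F V : Type*} [Field F] [AddCommGroup V] [Module F V]

/-- The order `n` of `X` is non-zero in `F`, so `X` is a root of the separable polynomial `T ^ n -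
1`. -/
theorem isSemisimple_of_isSemisimpleElement [Finite F] {X : V ≃ₗ[F] V}
    (hX : IsSemisimpleElement X) : IsSemisimple (X : End F V) := by
  have hn : ((orderOf X : ℕ) : F) ≠ 0 := by
    intro h
    have h1 := (CharP.cast_eq_zero_iff F (ringChar F) _).1 h
    exact CharP.ringChar_ne_one (R := F) (Nat.eq_one_of_dvd_coprimes hX h1 dvd_rfl)
  refine isSemisimple_of_squarefree_aeval_eq_zero
    (X_pow_sub_one_separable_iff.2 hn).squarefree ?_
  rw [map_sub, map_pow, aeval_X, map_one, sub_eq_zero]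
  refine LinearMap.ext fun v ↦ ?_
  have := LinearEquiv.congr_fun (pow_orderOf_eq_one X) v
  have h2 : ∀ n : ℕ, ((X : End F V) ^ n) v = (X ^ n) v := fun n ↦ by
    induction n with
    | zero => rfl
    | succ n ih => rw [pow_succ', pow_succ', End.mul_apply, ih]; rfl
  rw [h2, this]; rfl

theorem aeval_mul_X_apply (f : End F V) (p : F[X]) (v : V) :
    aeval f (p * X) v = aeval f p (f v) := by
  rw [map_mul, aeval_X, End.mul_apply]

theorem coe_aeval_restrict_apply {f : End F V} {W : Submodule F V} (hW : W ∈ f.invtSubmodule)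
    (p : F[X]) (w : W) :
    (aeval (LinearMap.restrict f hW) p w : V) = aeval f p w := by
  induction p using Polynomial.induction_on generalizing w with
  | C a => simp [algebraMap_end_apply]
  | add p q hp hq => simp [hp, hq]
  | monomial n a ih =>
    rw [pow_succ, ← mul_assoc, aeval_mul_X_apply, aeval_mul_X_apply, ih]
    rfl

theorem aeval_mem_invtSubmodule {f : End F V} {W : Submodule F V} (hW : W ∈ f.invtSubmodule)
    (p : F[X]) : W ∈ (aeval f p).invtSubmodule := fun w hw ↦ by
  have := coe_aeval_restrict_apply hW p ⟨w, hw⟩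
  rw [Submodule.mem_comap, ← this]
  exact Subtype.prop _

theorem commute_projection {f : End F V} {W U : Submodule F V} (hWU : IsCompl W U)
    (hW : W ∈ f.invtSubmodule) (hU : U ∈ f.invtSubmodule) : Commute f (W.projection U hWU) := by
  refine LinearMap.ext fun x ↦ ?_
  obtain ⟨w, hw, u, hu, rfl⟩ := Submodule.mem_sup.1 (hWU.sup_eq_top ▸ Submodule.mem_top : x ∈ W ⊔ U)
  simp [map_add, Submodule.projection_apply_of_mem_left hWU hw,
    Submodule.projection_apply_of_mem_right hWU hu,
    Submodule.projection_apply_of_mem_left hWU (hW hw),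
    Submodule.projection_apply_of_mem_right hWU (hU hu)]

theorem adjoint_aeval {σ : F →+* F} {β : V →ₛₗ[σ] V →ₗ[F] F}
    {T T' : End F V} (h : ∀ u v, β (T u) v = β u (T' v)) (p : F[X]) (u v : V) :
    β (aeval T p u) v = β u (aeval T' (p.map σ) v) := by
  induction p using Polynomial.induction_on generalizing u v with
  | C a => simp [algebraMap_end_apply]
  | add p q hp hq => simp [hp, hq]
  | monomial n a ih =>
    rw [pow_succ, ← mul_assoc, aeval_mul_X_apply, ih, h, Polynomial.map_mul (q := X), map_X,
      mul_comm _ X, map_mul, aeval_X, End.mul_apply]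

variable [FiniteDimensional F V]

theorem IsMinimalInvariant.exists_det_aeval_eq [Finite F] {f : End F V} {W : Submodule F V}
    (h : IsMinimalInvariant f W) (a : F) :
    ∃ p : F[X], LinearMap.det (LinearMap.restrict (aeval f p)
      (aeval_mem_invtSubmodule h.2.1 p)) = a := by
  have : Nontrivial W := Submodule.nontrivial_iff_ne_bot.2 h.1
  have hirr : ∀ U ∈ invtSubmodule (LinearMap.restrict f h.2.1), U = ⊥ ∨ U = ⊤ := fun U hU ↦ by
    have := h.2.2 (U.map W.subtype) (Submodule.map_subtype_le W U) (by
      rintro _ ⟨w, hw, rfl⟩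
      exact ⟨_, hU hw, rfl⟩)
    refine this.imp (fun h0 ↦ ?_) fun h1 ↦ ?_
    · refine eq_bot_iff.2 fun x hx ↦ Subtype.ext ?_
      exact (Submodule.mem_bot F).1 (h0 ▸ Submodule.mem_map_of_mem hx)
    · rw [eq_top_iff]
      rintro ⟨w, hw⟩ -
      rw [← h1] at hw
      obtain ⟨w', hw', rfl⟩ := hw
      exact hw'
  obtain ⟨p, hp⟩ := ClassicalGroups.exists_det_aeval_eq hirr a
  refine ⟨p, hp ▸ congrArg LinearMap.det (LinearMap.ext fun w ↦ Subtype.ext ?_)⟩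
  exact (coe_aeval_restrict_apply h.2.1 p w).symm

theorem det_mul_projection_add {g : End F V} {W U : Submodule F V} (hWU : IsCompl W U)
    (hg : W ∈ g.invtSubmodule) :
    LinearMap.det (g * W.projection U hWU + (1 - W.projection U hWU)) =
      LinearMap.det (LinearMap.restrict g hg) := by
  set w := g * W.projection U hWU + (1 - W.projection U hWU) with hw
  have hinv : W ≤ W.comap w := fun x hx ↦ by
    have := Submodule.projection_apply_of_mem_left hWU hx
    simpa [hw, this] using hg hx
  rw [LinearMap.det_eq_det_mul_det W w hinv]
  -- The operator differs from the identity by a map into `W`, so only its restriction to `W`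
  -- contributes to the determinant.
  have h1 : W.mapQ W w hinv = LinearMap.id := by
    refine Submodule.linearMap_qext _ (LinearMap.ext fun x ↦ ?_)
    simp only [LinearMap.comp_apply, Submodule.mkQ_apply, Submodule.mapQ_apply, LinearMap.id_apply]
    rw [Submodule.Quotient.eq]
    have h2 : w x - x = g (W.projection U hWU x) - W.projection U hWU x := by
      simp [hw]; abel
    rw [h2]
    exact W.sub_mem (hg (Submodule.projection_apply_mem hWU x))
      (Submodule.projection_apply_mem hWU x)
  rw [h1, LinearMap.det_id, mul_one]
  congr 1
  refine LinearMap.ext fun x ↦ Subtype.ext ?_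
  have := Submodule.projection_apply_left hWU x
  simp [hw, this]
  rfl

variable {σ : F →+* F} {β : V →ₛₗ[σ] V →ₗ[F] F}

theorem finrank_le_finrank_add_orthogonal (β : V →ₛₗ[σ] V →ₗ[F] F) (W : Submodule F V) :
    finrank F V ≤ finrank F W + finrank F (W.orthogonalBilin β) := by
  let b := finBasis F W
  let φ : V →ₗ[F] (Fin (finrank F W) → F) := LinearMap.pi fun i ↦ β (b i)
  have hk : LinearMap.ker φ = W.orthogonalBilin β := by
    ext x
    rw [LinearMap.mem_ker, Submodule.mem_orthogonalBilin_iff]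
    constructor
    · intro h w hw
      have h1 : ((∑ i, b.repr ⟨w, hw⟩ i • b i : W) : V) = w := by rw [b.sum_repr]
      rw [← h1, Submodule.coe_sum, map_sum, LinearMap.sum_apply]
      refine Finset.sum_eq_zero fun i _ ↦ ?_
      have h2 : β (b i) x = 0 := congrFun h i
      rw [Submodule.coe_smul, LinearMap.map_smulₛₗ, LinearMap.smul_apply, h2, smul_zero]
    · exact fun h ↦ funext fun i ↦ h _ (b i).2
  rw [← hk, ← LinearMap.finrank_range_add_finrank_ker φ]
  gcongr
  exact (Submodule.finrank_le _).trans (by simp)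

/-- The second disjointness forces `dim W' ≤ dim W`, which makes the dimensions in the first add up
to at least `dim V`. -/
theorem isCompl_orthogonal_of_disjoint {W W' : Submodule F V}
    (h : Disjoint W (W'.orthogonalBilin β)) (h' : Disjoint W' (W.orthogonalBilin β)) :
    IsCompl W (W'.orthogonalBilin β) := by
  have h1 := finrank_le_finrank_add_orthogonal β W
  have h2 := Submodule.finrank_add_finrank_le_of_disjoint h'
  have h3 := finrank_le_finrank_add_orthogonal β W'
  exact ⟨h, codisjoint_iff.2 (Submodule.eq_top_of_disjoint _ _ (by omega) h)⟩

theorem map_eq_of_mem_invtSubmodule (X : V ≃ₗ[F] V) {W : Submodule F V}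
    (hW : W ∈ invtSubmodule (X : End F V)) : W.map (X : End F V) = W :=
  Submodule.eq_of_le_of_finrank_eq (Submodule.map_le_iff_le_comap.2 hW)
    (LinearEquiv.finrank_map_eq X W)

theorem orthogonal_mem_invtSubmodule {X : V ≃ₗ[F] V} (hX : X ∈ unitaryGroup β)
    {W : Submodule F V} (hW : W ∈ invtSubmodule (X : End F V)) :
    W.orthogonalBilin β ∈ invtSubmodule (X : End F V) := by
  intro y hy x hx
  rw [← map_eq_of_mem_invtSubmodule X hW] at hx
  obtain ⟨x', hx', rfl⟩ := hx
  exact (hX x' y).trans (hy x' hx')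

/-- A semisimple isometry has two paired minimal invariant subspaces, equal or both isotropic. -/
theorem exists_isMinimalInvariant_pair [Nontrivial V] (hs : β.IsSymm) (hβ : β.Nondegenerate)
    {X : V ≃ₗ[F] V} (hX : X ∈ unitaryGroup β) (hss : IsSemisimple (X : End F V)) :
    ∃ W W' : Submodule F V, IsMinimalInvariant (X : End F V) W ∧
      IsMinimalInvariant (X : End F V) W' ∧
      Disjoint W (W'.orthogonalBilin β) ∧ Disjoint W' (W.orthogonalBilin β) ∧
      (W = W' ∨ (W ≤ W.orthogonalBilin β ∧ W' ≤ W'.orthogonalBilin β)) := by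
  have hor : ∀ W U : Submodule F V, IsMinimalInvariant (X : End F V) W →
      U ∈ invtSubmodule (X : End F V) → Disjoint W U ∨ W ≤ U := fun W U hW hU ↦ by
    refine (hW.2.2 (W ⊓ U) inf_le_left ?_).imp disjoint_iff.2 inf_eq_left.1
    exact fun x hx ↦ ⟨hW.2.1 hx.1, hU hx.2⟩
  obtain ⟨W, -, hW⟩ := exists_isMinimalInvariant_le (f := (X : End F V)) (U := ⊤) top_ne_bot
    (fun _ _ ↦ Submodule.mem_top)
  have hWo := orthogonal_mem_invtSubmodule hX hW.2.1
  rcases hor W _ hW hWo with h | hiso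
  · exact ⟨W, W, hW, hW, h, h, .inl rfl⟩
  obtain ⟨U, hU, hWU⟩ := isSemisimple_iff.1 hss _ hWo
  -- Otherwise `W` would lie in the radical of `β`.
  have hU0 : U ≠ ⊥ := by
    rintro rfl
    have h1 : W.orthogonalBilin β = ⊤ := by simpa using hWU.sup_eq_top
    refine hW.1 (eq_bot_iff.2 fun x hx ↦ hβ.1 x fun y ↦ ?_)
    have : y ∈ W.orthogonalBilin β := h1 ▸ Submodule.mem_top
    exact this x hx
  obtain ⟨W', hW'U, hW'⟩ := exists_isMinimalInvariant_le hU0 hU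
  have hW'o := orthogonal_mem_invtSubmodule hX hW'.2.1
  have hd : Disjoint W' (W.orthogonalBilin β) := hWU.symm.disjoint.mono_left hW'U
  rcases hor W' _ hW' hW'o with h | hiso'
  · exact ⟨W', W', hW', hW', h, h, .inl rfl⟩
  refine ⟨W, W', hW, hW', (hor W _ hW hW'o).resolve_right fun h ↦ hW'.1 ?_, hd, .inr ⟨hiso, hiso'⟩⟩
  have hle : W' ≤ W.orthogonalBilin β := fun x hx y hy ↦ hs.isRefl _ _ (h hy x hx)
  exact disjoint_self.1 (hd.mono_right hle)

end Unitary

end ClassicalGroups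

namespace ClassicalGroups

open Module Module.End Polynomial

/-! ### Isometries of prescribed determinant in the centralizer -/

section Unitary

variable {F V : Type*} [Field F] [AddCommGroup V] [Module F V]
variable {σ : F →+* F} {β : V →ₛₗ[σ] V →ₗ[F] F}

theorem adjoint_projection (hs : β.IsSymm) {W W' : Submodule F V}
    (h : IsCompl W (W'.orthogonalBilin β)) (h' : IsCompl W' (W.orthogonalBilin β)) (u v : V) :
    β (W.projection _ h u) v = β u (W'.projection _ h' v) := by
  obtain ⟨a, ha, b, hb, rfl⟩ :=
    Submodule.mem_sup.1 (h.sup_eq_top ▸ Submodule.mem_top : u ∈ W ⊔ W'.orthogonalBilin β)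
  obtain ⟨c, hc, d, hd, rfl⟩ :=
    Submodule.mem_sup.1 (h'.sup_eq_top ▸ Submodule.mem_top : v ∈ W' ⊔ W.orthogonalBilin β)
  have h1 : β a d = 0 := hd a ha
  have h2 : β b c = 0 := hs.isRefl _ _ (hb c hc)
  simp only [map_add, Submodule.projection_apply_of_mem_left h ha,
    Submodule.projection_apply_of_mem_right h hb, Submodule.projection_apply_of_mem_left h' hc,
    Submodule.projection_apply_of_mem_right h' hd, LinearMap.add_apply, h1, h2, add_zero]

theorem projection_mul_projection_eq_zero {W U W' U' : Submodule F V}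
    (h : IsCompl W U) (h' : IsCompl W' U') (hle : W' ≤ U) :
    W.projection U h * W'.projection U' h' = 0 :=
  LinearMap.ext fun _ ↦
    Submodule.projection_apply_of_mem_right h (hle (Submodule.projection_apply_mem h' _))

variable [FiniteDimensional F V]

/-- The centralizer of a semisimple isometry contains isometries of determinant `a / σ a`. -/
theorem exists_commute_det_mul_eq [Finite F] [Nontrivial V] (hs : β.IsSymm)
    (hβ : β.Nondegenerate) {X : V ≃ₗ[F] V} (hX : X ∈ unitaryGroup β)
    (hss : IsSemisimple (X : End F V)) {a : F} (ha : a ≠ 0) :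
    ∃ u ∈ unitaryGroup β, Commute u X ∧ LinearMap.det (u : End F V) * σ a = a := by
  obtain ⟨W, W', hW, hW', hd, hd', hor⟩ := exists_isMinimalInvariant_pair hs hβ hX hss
  have hc := isCompl_orthogonal_of_disjoint hd hd'
  have hc' := isCompl_orthogonal_of_disjoint hd' hd
  obtain ⟨p, hp⟩ := hW.exists_det_aeval_eq a
  set π := W.projection _ hc
  set π' := W'.projection _ hc'
  set Y : End F V := ((X⁻¹ : V ≃ₗ[F] V) : End F V)
  set g := aeval (X : End F V) p
  set g' := aeval Y (p.map σ) with hg'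
  set w : End F V := g * π + (1 - π) with hw
  set w' : End F V := g' * π' + (1 - π') with hw'
  have hXY : Commute (X : End F V) Y := by
    refine LinearMap.ext fun v ↦ ?_
    exact LinearEquiv.congr_fun ((mul_inv_cancel X).trans (inv_mul_cancel X).symm) v
  have hadjX : ∀ u v, β ((X : End F V) u) v = β u (Y v) := fun u v ↦ by
    have := hX u (X⁻¹ v)
    rwa [← LinearEquiv.mul_apply, mul_inv_cancel] at this
  -- The dichotomy for the pair is needed here: the projections are equal, or isotropy makes both
  -- products vanish.
  have hππ' : Commute π π' := by
    rcases hor with rfl | ⟨h1, h2⟩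
    · exact Commute.refl _
    · exact (projection_mul_projection_eq_zero hc hc' h2).trans
        (projection_mul_projection_eq_zero hc' hc h1).symm
  have hXπ : Commute (X : End F V) π :=
    commute_projection hc hW.2.1 (orthogonal_mem_invtSubmodule hX hW'.2.1)
  have hXπ' : Commute (X : End F V) π' :=
    commute_projection hc' hW'.2.1 (orthogonal_mem_invtSubmodule hX hW.2.1)
  have hYof : ∀ {k : End F V}, Commute (X : End F V) k → Commute Y k := fun {k} hk ↦ by
    refine LinearMap.ext fun v ↦ X.injective ?_
    have h1 := LinearMap.congr_fun hk.eq (Y v)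
    have h2 : ∀ v, X (Y v) = v := fun v ↦ LinearEquiv.congr_fun (mul_inv_cancel X) v
    simp only [End.mul_apply, LinearEquiv.coe_coe, h2] at h1 ⊢
    exact h1.symm
  have haeval : ∀ {f k : End F V} (p : F[X]), Commute f k → Commute (aeval f p) k :=
    fun {f k} p hk ↦ by
      induction p using Polynomial.induction_on' with
      | add p q hp hq => rw [map_add]; exact hp.add_left hq
      | monomial n a =>
        rw [aeval_monomial]
        exact (Algebra.commute_algebraMap_left _ _).mul_left (hk.pow_left n)
  have hXw : Commute (X : End F V) w :=
    (((haeval p (Commute.refl _)).symm.mul_right hXπ).add_right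
      ((Commute.one_right _).sub_right hXπ))
  have hXw' : Commute (X : End F V) w' :=
    (((haeval _ hXY.symm).symm.mul_right hXπ').add_right
      ((Commute.one_right _).sub_right hXπ'))
  have hπw' : Commute π w' :=
    (((haeval _ (hYof hXπ)).symm.mul_right hππ').add_right
      ((Commute.one_right _).sub_right hππ'))
  have hww' : Commute w w' :=
    ((haeval p hXw').mul_left hπw').add_left ((Commute.one_left _).sub_left hπw')
  have hadjπ : ∀ u v, β (π u) v = β u (π' v) := adjoint_projection hs hc hc'
  have hgπ' : Commute g' π' := haeval _ (hYof hXπ')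
  have hadj : ∀ u v, β (w u) v = β u (w' v) := fun u v ↦ by
    have h1 := adjoint_aeval hadjX p (π u) v
    have h2 : π' (g' v) = (g' * π') v := LinearMap.congr_fun hgπ'.eq.symm v
    rw [hadjπ, ← hg', h2] at h1
    simp only [hw, hw', LinearMap.add_apply, LinearMap.sub_apply, map_add, map_sub, End.one_apply,
      hadjπ]
    rw [End.mul_apply, h1]
  have hdet : LinearMap.det w = a := (det_mul_projection_add hc _).trans hp
  have hdet' : LinearMap.det w' = σ a := (det_eq_of_adjoint hβ.2 hadj).trans (by rw [hdet])
  have hσa : σ a ≠ 0 := (map_ne_zero σ).2 ha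
  let e := w.equivOfDetNeZero (hdet ▸ ha)
  let e' := w'.equivOfDetNeZero (hdet' ▸ hσa)
  have he (v : V) : e v = w v := rfl
  have he' (v : V) : e' v = w' v := rfl
  have hee' : Commute e e' := LinearEquiv.ext fun v ↦ LinearMap.congr_fun hww'.eq v
  have hXe : Commute X e := LinearEquiv.ext fun v ↦ LinearMap.congr_fun hXw.eq v
  have hXe' : Commute X e' := LinearEquiv.ext fun v ↦ LinearMap.congr_fun hXw'.eq v
  -- Since `w` and `w'` are commuting adjoints, `w'⁻¹ * w` preserves `β`, as `z / σ z` has norm one.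
  refine ⟨e'⁻¹ * e, fun x y ↦ ?_, (hXe'.inv_right.mul_right hXe).symm, ?_⟩
  · have hx : w' ((e'⁻¹ * e) x) = w x :=
      LinearEquiv.congr_fun (mul_inv_cancel_left e' e) x
    have hy : (e'⁻¹ * e) y = w (e'⁻¹ y) :=
      LinearEquiv.congr_fun hee'.inv_right.eq.symm y
    have hy' : w' (e'⁻¹ y) = y := LinearEquiv.congr_fun (mul_inv_cancel e') y
    rw [hy, ← hs.eq, hadj, hs.eq, hx, hadj, hy']
  · have h1 : w' * ((e'⁻¹ * e : V ≃ₗ[F] V) : End F V) = w :=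
      LinearMap.ext fun v ↦ LinearEquiv.congr_fun (mul_inv_cancel_left e' e) v
    have h2 := congrArg LinearMap.det h1
    rwa [map_mul, hdet', hdet, mul_comm] at h2

end Unitary

end ClassicalGroups

namespace ClassicalGroups

open Module Module.End Polynomial

/-! ### Hilbert 90 and the unitary classes -/

theorem exists_mul_pow_eq_self {F : Type*} [Field F] [Finite F] {q : ℕ}
    (hq : Nat.card F = q ^ 2) {c : F} (hc : c * c ^ q = 1) : ∃ a ≠ 0, c * a ^ q = a := by
  have hqq : ∀ z : F, (z ^ q) ^ q = z := fun z ↦ by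
    have := Fintype.ofFinite F
    rw [← pow_mul, ← sq, ← hq, Nat.card_eq_fintype_card, FiniteField.pow_card]
  by_cases h : ∃ z : F, z + c * z ^ q ≠ 0
  · obtain ⟨z, hz⟩ := h
    -- The Hilbert 90 witness `a = z + c * z ^ q`.
    refine ⟨_, hz, ?_⟩
    rw [add_pow_of_card_eq_sq hq, mul_pow, hqq, mul_add, ← mul_assoc, hc]
    ring
  · push Not at h
    have h1 : c = -1 := by
      have := h 1
      rw [one_pow, mul_one] at this
      exact (neg_eq_of_add_eq_zero_right this).symm
    subst h1
    have h2 : ∀ z : F, z ^ q = z := fun z ↦ by linear_combination -h z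
    -- If every witness vanishes, `z ↦ z ^ q` is the identity; a generator of `Fˣ`, of order `q ^ 2
    -- - 1`, excludes this.
    obtain ⟨g, hg⟩ := IsCyclic.exists_generator (α := Fˣ)
    have hq2 : 2 ≤ q := by
      by_contra hlt
      have := Finite.one_lt_card (α := F)
      interval_cases q <;> omega
    have h3 : g ^ (q - 1) = 1 := by
      have : g ^ (q - 1) * g = 1 * g := by
        rw [← pow_succ, one_mul, Nat.sub_add_cancel (by omega)]
        exact Units.ext (h2 g)
      exact mul_right_cancel this
    have h4 := orderOf_le_of_pow_eq_one (by omega) h3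
    rw [orderOf_eq_card_of_forall_mem_zpowers hg, Nat.card_units, hq] at h4
    have : q * 2 ≤ q ^ 2 := by rw [sq]; gcongr
    omega

section Conjugacy

variable {F V : Type*} [Field F] [AddCommGroup V] [Module F V]

theorem conjClass_special_eq {C : Subgroup (V ≃ₗ[F] V)} {X : V ≃ₗ[F] V}
    (h : ∀ g ∈ C, ∃ u ∈ C, Commute u X ∧ LinearEquiv.det u = LinearEquiv.det g) :
    conjClass (special C) X = conjClass C X := by
  ext Y
  constructor
  · rintro ⟨g, hg, rfl⟩
    exact ⟨g, hg.1, rfl⟩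
  · rintro ⟨g, hg, rfl⟩
    obtain ⟨u, hu, huX, hdet⟩ := h g hg
    refine ⟨u⁻¹ * g, ⟨C.mul_mem (C.inv_mem hu) hg, ?_⟩, ?_⟩
    · change LinearEquiv.det (u⁻¹ * g) = 1
      rw [map_mul, map_inv, hdet, inv_mul_cancel]
    · have h1 : u * X * u⁻¹ = X := by rw [huX.eq, mul_inv_cancel_right]
      calc g⁻¹ * X * g = g⁻¹ * (u * X * u⁻¹) * g := by rw [h1]
        _ = (u⁻¹ * g)⁻¹ * X * (u⁻¹ * g) := by group

variable {σ : F →+* F} {β : V →ₛₗ[σ] V →ₗ[F] F}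

theorem apply_eq_apply_inv {g : V ≃ₗ[F] V} (hg : g ∈ unitaryGroup β) (u v : V) :
    β (g u) v = β u (g⁻¹ v) := by
  have := hg u (g⁻¹ v)
  rwa [← LinearEquiv.mul_apply, mul_inv_cancel] at this

variable [FiniteDimensional F V]

theorem det_mul_map_det_eq_one (hβ : β.Nondegenerate) {g : V ≃ₗ[F] V} (hg : g ∈ unitaryGroup β) :
    LinearMap.det (g : End F V) * σ (LinearMap.det (g : End F V)) = 1 := by
  rw [← det_eq_of_adjoint (T' := ((g⁻¹ : V ≃ₗ[F] V) : End F V)) hβ.2 (apply_eq_apply_inv hg),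
    ← map_mul]
  have : (g : End F V) * ((g⁻¹ : V ≃ₗ[F] V) : End F V) = 1 :=
    LinearMap.ext fun v ↦ LinearEquiv.congr_fun (mul_inv_cancel g) v
  rw [this, map_one]

end Conjugacy

theorem conjClass_special_unitaryGroup {F V : Type*} [Field F] [Finite F] [AddCommGroup V]
    [Module F V] [FiniteDimensional F V] [Nontrivial V] {q : ℕ} (hq : Nat.card F = q ^ 2)
    {β : V →ₛₗ[bar hq] V →ₗ[F] F} (hs : β.IsSymm) (hβ : β.Nondegenerate) {X : V ≃ₗ[F] V}
    (hX : X ∈ unitaryGroup β) (hss : IsSemisimpleElement X) :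
    conjClass (special (unitaryGroup β)) X = conjClass (unitaryGroup β) X := by
  refine conjClass_special_eq fun g hg ↦ ?_
  obtain ⟨a, ha, hca⟩ := exists_mul_pow_eq_self hq (det_mul_map_det_eq_one hβ hg)
  obtain ⟨u, hu, huX, hdet⟩ :=
    exists_commute_det_mul_eq hs hβ hX (isSemisimple_of_isSemisimpleElement hss) ha
  refine ⟨u, hu, huX, Units.ext ?_⟩
  rw [LinearEquiv.coe_det, LinearEquiv.coe_det]
  exact mul_right_cancel₀ (pow_ne_zero q ha) (hdet.trans hca.symm)

end ClassicalGroups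

namespace ClassicalGroups

open Module Module.End Polynomial

/-! ### Geometric sums of an element of finite order -/

section Ring

variable {A : Type*} [Ring A] {a b : A} {n : ℕ}

theorem geom_sum_mul_self (ha : a ^ n = 1) :
    (∑ i ∈ Finset.range n, a ^ i) * a = ∑ i ∈ Finset.range n, a ^ i := by
  have := geom_sum_mul a n
  rwa [ha, sub_self, mul_sub, mul_one, sub_eq_zero] at this

theorem mul_pow_eq_self (h : b * a = b) (i : ℕ) : b * a ^ i = b := by
  induction i with
  | zero => rw [pow_zero, mul_one]
  | succ i ih => rw [pow_succ, ← mul_assoc, ih, h]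

theorem geom_sum_mul_geom_sum (hab : a * b = 1) (ha : a ^ n = 1) :
    (∑ i ∈ Finset.range n, a ^ i) * ∑ i ∈ Finset.range n, b ^ i =
      n • ∑ i ∈ Finset.range n, a ^ i := by
  have h : (∑ i ∈ Finset.range n, a ^ i) * b = ∑ i ∈ Finset.range n, a ^ i := by
    conv_lhs => rw [← geom_sum_mul_self ha, mul_assoc, hab, mul_one]
  rw [Finset.mul_sum, Finset.sum_congr rfl fun i _ ↦ mul_pow_eq_self h i, Finset.sum_const,
    Finset.card_range]

/-- Both sides are the product of the two commuting sums. For `b` adjoint to `a` and `n` invertible,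
this makes the sum self-adjoint. -/
theorem nsmul_geom_sum_eq (hab : a * b = 1) (hba : b * a = 1) (ha : a ^ n = 1) (hb : b ^ n = 1) :
    n • ∑ i ∈ Finset.range n, a ^ i = n • ∑ i ∈ Finset.range n, b ^ i := by
  rw [← geom_sum_mul_geom_sum hab ha, ← geom_sum_mul_geom_sum hba hb]
  have h : Commute a b := hab.trans hba.symm
  exact Commute.sum_left _ _ _ fun i _ ↦ Commute.sum_right _ _ _ fun j _ ↦ h.pow_pow i j

end Ring

/-! ### Reflections and the orthogonal classes -/

section Orthogonal

variable {F V : Type*} [Field F] [AddCommGroup V] [Module F V]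
  {Q : QuadraticForm F V}

theorem mem_unitaryGroup_polarBilin {X : V ≃ₗ[F] V} (hX : X ∈ orthogonalGroup Q) :
    X ∈ unitaryGroup (σ := RingHom.id F) Q.polarBilin := fun u v ↦ by
  have h : ∀ x, Q (X x) = Q x := hX
  simp only [QuadraticMap.polarBilin_apply_apply, QuadraticMap.polar, ← map_add, h]

theorem exists_map_ne_zero_of_polar_ne_zero {u v : V} {E : Submodule F V} (hu : u ∈ E) (hv : v ∈ E)
    (h : QuadraticMap.polar Q u v ≠ 0) : ∃ w ∈ E, Q w ≠ 0 := by
  by_contra! hE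
  exact h (by rw [QuadraticMap.polar, hE _ (E.add_mem hu hv), hE _ hu, hE _ hv]; ring)

variable [FiniteDimensional F V]

theorem exists_reflection {v : V} (hv : Q v ≠ 0) :
    ∃ Z ∈ orthogonalGroup Q, LinearEquiv.det Z = -1 ∧
      ∀ x, Z x = x - (QuadraticMap.polar Q v x / Q v) • v := by
  let f : Dual F V := (-(Q v)⁻¹) • Q.polarBilin v
  have hf (x : V) : f x = -(QuadraticMap.polar Q v x / Q v) := by
    simp [f, div_eq_mul_inv, mul_comm]
  have hfv : f v = -2 := by
    rw [hf, QuadraticMap.polar_self, nsmul_eq_mul, mul_div_cancel_right₀ _ hv, Nat.cast_ofNat]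
  have hu : IsUnit (1 + f v) := by rw [hfv]; norm_num
  have hZ (x : V) : LinearEquiv.dilatransvection hu x
      = x - (QuadraticMap.polar Q v x / Q v) • v := by
    rw [LinearEquiv.dilatransvection.apply, hf, neg_smul, sub_eq_add_neg]
  refine ⟨LinearEquiv.dilatransvection hu, fun x ↦ ?_, Units.ext ?_, hZ⟩
  · rw [hZ, sub_eq_add_neg, QuadraticMap.map_add Q, QuadraticMap.map_neg, QuadraticMap.map_smul,
      QuadraticMap.polar_neg_right, QuadraticMap.polar_smul_right, QuadraticMap.polar_comm Q x v]
    simp only [smul_eq_mul]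
    field_simp
    ring
  · rw [LinearEquiv.coe_det, LinearEquiv.dilatransvection.coe_toLinearMap,
      LinearMap.transvection.det, hfv]
    norm_num

theorem det_eq_one_or_neg_one (hQ : Q.polarBilin.Nondegenerate) {g : V ≃ₗ[F] V}
    (hg : g ∈ orthogonalGroup Q) : LinearEquiv.det g = 1 ∨ LinearEquiv.det g = -1 := by
  have := det_mul_map_det_eq_one (σ := RingHom.id F) hQ (mem_unitaryGroup_polarBilin hg)
  rcases mul_self_eq_one_iff.1 this with h | h
  · exact .inl (Units.ext (by simpa using h))
  · exact .inr (Units.ext (by simpa using h))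

theorem exists_det_eq_neg_one [Nontrivial V] (hQ : Q.polarBilin.Nondegenerate) :
    ∃ Z ∈ orthogonalGroup Q, LinearEquiv.det Z = -1 := by
  obtain ⟨v, hv⟩ := exists_ne (0 : V)
  have : ∃ u, QuadraticMap.polar Q v u ≠ 0 := by
    by_contra! h
    exact hv (hQ.1 v h)
  obtain ⟨u, hu⟩ := this
  obtain ⟨w, -, hw⟩ := exists_map_ne_zero_of_polar_ne_zero (E := ⊤) Submodule.mem_top
    Submodule.mem_top hu
  obtain ⟨Z, hZ, hdet, -⟩ := exists_reflection hw
  exact ⟨Z, hZ, hdet⟩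

/-- An eigenspace of a semisimple isometry for the eigenvalue `1` or `-1` contains a vector that
is not isotropic. -/
theorem exists_eigenvector_map_ne_zero (hQ : Q.polarBilin.Nondegenerate) {X : V ≃ₗ[F] V}
    (hX : X ∈ orthogonalGroup Q) (hss : IsSemisimple (X : End F V)) {ε : F} (hε : ε * ε = 1)
    {v : V} (hv : v ≠ 0) (hXv : X v = ε • v) : ∃ w, X w = ε • w ∧ Q w ≠ 0 := by
  let N : End F V := (X : End F V) - algebraMap F (End F V) ε
  have hN (x : V) : N x = X x - ε • x := rfl
  let E := LinearMap.ker N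
  have hE (x : V) : x ∈ E ↔ X x = ε • x := by rw [LinearMap.mem_ker, hN, sub_eq_zero]
  obtain ⟨U, hU, hEU⟩ := isSemisimple_iff.1 hss E fun x hx ↦ by
    rw [hE] at hx
    rw [Submodule.mem_comap, LinearEquiv.coe_coe, hE, hx, map_smul, hx]
  -- Semisimplicity excludes Jordan blocks for `ε`, so `V` is the sum of the range and the kernel of
  -- `N`. These are orthogonal because `ε * ε = 1`, hence the form is non-degenerate on `E`.
  have hd : Disjoint (LinearMap.range N) E := by
    rw [Submodule.disjoint_def]
    rintro _ ⟨y, rfl⟩ hy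
    obtain ⟨e, he, u, hu, rfl⟩ :=
      Submodule.mem_sup.1 (hEU.sup_eq_top ▸ Submodule.mem_top : y ∈ E ⊔ U)
    rw [map_add, LinearMap.mem_ker.1 he, zero_add] at hy ⊢
    refine Submodule.disjoint_def.1 hEU.disjoint _ hy ?_
    exact U.sub_mem (hU hu) (U.smul_mem ε hu)
  have htop := Submodule.eq_top_of_disjoint _ _ (LinearMap.finrank_range_add_finrank_ker N).ge hd
  have hvE : v ∈ E := (hE v).2 hXv
  have hpol : ∃ u ∈ E, QuadraticMap.polar Q v u ≠ 0 := by
    by_contra! h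
    refine hv (hQ.1 v fun y ↦ ?_)
    obtain ⟨_, ⟨y, rfl⟩, u, hu, rfl⟩ :=
      Submodule.mem_sup.1 (htop ▸ Submodule.mem_top : y ∈ LinearMap.range N ⊔ E)
    have h1 : Q.polarBilin (X v) (X y) = Q.polarBilin v y := mem_unitaryGroup_polarBilin hX v y
    rw [hXv, map_smul, LinearMap.smul_apply, smul_eq_mul] at h1
    have h2 : Q.polarBilin v u = 0 := h u hu
    rw [map_add, h2, add_zero, hN, map_sub, map_smul, smul_eq_mul, ← h1, ← mul_assoc, hε, one_mul,
      sub_self]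
  obtain ⟨u, hu, hvu⟩ := hpol
  obtain ⟨w, hw, hQw⟩ := exists_map_ne_zero_of_polar_ne_zero hvE hu hvu
  exact ⟨w, (hE w).1 hw, hQw⟩

theorem exists_commute_det_eq_neg_one (hQ : Q.polarBilin.Nondegenerate) {X : V ≃ₗ[F] V}
    (hX : X ∈ orthogonalGroup Q) (hss : IsSemisimple (X : End F V))
    (h : ¬ IsUnit ((X : End F V) ^ 2 - 1 : End F V)) :
    ∃ u ∈ orthogonalGroup Q, Commute u X ∧ LinearEquiv.det u = -1 := by
  have hev : ∃ ε : F, ε * ε = 1 ∧ ∃ v ≠ 0, X v = ε • v := by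
    rw [LinearMap.isUnit_iff_ker_eq_bot, LinearMap.ker_eq_bot'] at h
    push Not at h
    obtain ⟨v, hv, hv0⟩ := h
    have hXX : X (X v) = v := by
      rw [sq, LinearMap.sub_apply, sub_eq_zero] at hv
      exact hv
    by_cases h1 : X v = v
    · exact ⟨1, one_mul 1, v, hv0, by rw [h1, one_smul]⟩
    · refine ⟨-1, by ring, X v - v, sub_ne_zero.2 h1, ?_⟩
      rw [map_sub, hXX, neg_one_smul, neg_sub]
  obtain ⟨ε, hε, v, hv, hXv⟩ := hev
  obtain ⟨w, hw, hQw⟩ := exists_eigenvector_map_ne_zero hQ hX hss hε hv hXv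
  obtain ⟨Z, hZ, hdet, hZx⟩ := exists_reflection hQw
  refine ⟨Z, hZ, LinearEquiv.ext fun x ↦ ?_, hdet⟩
  have h1 : Q.polarBilin (X w) (X x) = Q.polarBilin w x := mem_unitaryGroup_polarBilin hX w x
  rw [hw, map_smul, LinearMap.smul_apply, smul_eq_mul, QuadraticMap.polarBilin_apply_apply,
    QuadraticMap.polarBilin_apply_apply] at h1
  rw [LinearEquiv.mul_apply, LinearEquiv.mul_apply, hZx, hZx, map_sub, map_smul, hw, smul_smul,
    ← h1]
  congr 2
  linear_combination (-QuadraticMap.polar Q w (X x) / Q w) * hε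

/-- Isometries of `2`-power order that commute with `X` have determinant `1` when `X ^ 2 - 1` is
invertible. -/
theorem det_eq_one_of_pow_two_pow (h2 : (2 : F) ≠ 0) (hQ : Q.polarBilin.Nondegenerate)
    {X h : V ≃ₗ[F] V} (hX : X ∈ orthogonalGroup Q) (hh : h ∈ orthogonalGroup Q)
    (hu : IsUnit ((X : End F V) ^ 2 - 1 : End F V)) (hc : Commute h X) {k : ℕ}
    (hk : h ^ 2 ^ (k + 1) = 1) : LinearMap.det (h : End F V) = 1 := by
  let toEnd : (V ≃ₗ[F] V) →* End F V := LinearEquiv.automorphismGroup.toLinearMapMonoidHom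
  let x : End F V := toEnd X
  let y : End F V := toEnd X⁻¹
  let a : End F V := -toEnd h
  let b : End F V := -toEnd h⁻¹
  have hxy : x * y = 1 := by rw [← map_mul, mul_inv_cancel, map_one]
  have hab : a * b = 1 := by rw [neg_mul_neg, ← map_mul, mul_inv_cancel, map_one]
  have hba : b * a = 1 := by rw [neg_mul_neg, ← map_mul, inv_mul_cancel, map_one]
  have heven : Even (2 ^ (k + 1)) := ⟨2 ^ k, by ring⟩
  have haN : a ^ 2 ^ (k + 1) = 1 := by rw [heven.neg_pow, ← map_pow, hk, map_one]
  have hbN : b ^ 2 ^ (k + 1) = 1 := by rw [heven.neg_pow, ← map_pow, inv_pow, hk, inv_one, map_one]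
  have hN : ((2 ^ (k + 1) : ℕ) : F) ≠ 0 := by
    rw [Nat.cast_pow]; exact pow_ne_zero _ (by exact_mod_cast h2)
  set n := 2 ^ (k + 1)
  -- As `a = -h`, `P` is `n` times the projection onto the `-1`-eigenspace of `h`; `n` is a power of
  -- `2`, hence invertible in `F`.
  let P := ∑ i ∈ Finset.range n, a ^ i
  have hPb : P = ∑ i ∈ Finset.range n, b ^ i := by
    have := nsmul_geom_sum_eq hab hba haN hbN
    rw [← Nat.cast_smul_eq_nsmul F, ← Nat.cast_smul_eq_nsmul F] at this
    exact smul_right_injective _ hN this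
  have hax : Commute a (x - y) :=
    ((hc.map toEnd).neg_left).sub_right ((hc.inv_right.map toEnd).neg_left)
  have hPx : Commute P (x - y) := Commute.sum_left _ _ _ fun i _ ↦ hax.pow_left i
  have hPa : P * a = P := geom_sum_mul_self haN
  have hPb' : P * b = P := by rw [hPb]; exact geom_sum_mul_self hbN
  have hPP : P * P = n • P := by
    conv_lhs => rw [Finset.mul_sum]
    rw [Finset.sum_congr rfl fun i _ ↦ mul_pow_eq_self hPa i, Finset.sum_const, Finset.card_range]
  -- `1 - a = 1 + h` is invertible away from the `-1`-eigenspace of `h`, where it vanishes; there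
  -- `(x - y) * P` acts as `n • (x - y)`. `T'` is the adjoint of `T`, because `x - y` is
  -- skew-adjoint and commutes with the self-adjoint `P`.
  let T := 1 - a + (x - y) * P
  let T' := 1 - b - (x - y) * P
  have hTb : T' = T * toEnd h⁻¹ := by
    have : T * b = b - 1 + (x - y) * P := by
      simp only [T, add_mul, sub_mul, hab, one_mul, mul_assoc, hPb']
    rw [show toEnd h⁻¹ = -b from (neg_neg _).symm, mul_neg, this]
    simp only [T']
    abel
  have hadjx : ∀ u v, Q.polarBilin (x u) v = Q.polarBilin u (y v) :=
    apply_eq_apply_inv (mem_unitaryGroup_polarBilin hX)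
  have hadjy : ∀ u v, Q.polarBilin (y u) v = Q.polarBilin u (x v) := fun u v ↦ by
    have := apply_eq_apply_inv (mem_unitaryGroup_polarBilin ((orthogonalGroup Q).inv_mem hX)) u v
    rwa [inv_inv] at this
  have hadja : ∀ u v, Q.polarBilin (a u) v = Q.polarBilin u (b v) := fun u v ↦ by
    have := apply_eq_apply_inv (mem_unitaryGroup_polarBilin hh) u v
    simp only [a, b, LinearMap.neg_apply, map_neg]
    exact congrArg Neg.neg this
  have hadjpow : ∀ i u v, Q.polarBilin ((a ^ i) u) v = Q.polarBilin u ((b ^ i) v) := fun i ↦ by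
    induction i with
    | zero => exact fun _ _ ↦ rfl
    | succ i ih =>
      intro u v
      rw [pow_succ, pow_succ', End.mul_apply, End.mul_apply, ih, hadja]
  have hadjP : ∀ u v, Q.polarBilin (P u) v = Q.polarBilin u (P v) := fun u v ↦ by
    conv_rhs => rw [hPb]
    simp only [P, LinearMap.sum_apply, map_sum, hadjpow]
  have hadjT : ∀ u v, Q.polarBilin (T u) v = Q.polarBilin u (T' v) := fun u v ↦ by
    have h1 : Q.polarBilin ((x - y) (P u)) v = -Q.polarBilin u ((x - y) (P v)) := by
      have h3 : (x - y) (P v) = P ((x - y) v) := LinearMap.congr_fun hPx.eq.symm v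
      rw [h3, ← hadjP]
      simp only [LinearMap.sub_apply, map_sub, hadjx, hadjy]
      ring
    simp only [T, T', LinearMap.add_apply, LinearMap.sub_apply (f := 1), map_add,
      LinearMap.sub_apply (f := 1 - b), map_sub, End.one_apply, End.mul_apply] at h1 ⊢
    simp only [LinearMap.sub_apply, map_sub] at h1 ⊢
    rw [h1, hadja]
    ring
  have hTinj : ∀ v, T v = 0 → v = 0 := fun v hv ↦ by
    have hPT : P * T = (n : F) • ((x - y) * P) := by
      simp only [T]
      rw [mul_add, mul_sub, mul_one, hPa, sub_self, zero_add, ← mul_assoc, hPx.eq, mul_assoc, hPP,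
        mul_smul_comm, Nat.cast_smul_eq_nsmul]
    have h1 : (x - y) (P v) = 0 := by
      have h3 := LinearMap.congr_fun hPT v
      rw [End.mul_apply, hv, map_zero, LinearMap.smul_apply] at h3
      exact (smul_eq_zero.1 h3.symm).resolve_left hN
    have h3 : P v = 0 := by
      refine LinearMap.ker_eq_bot'.1 ((LinearMap.isUnit_iff_ker_eq_bot _).1 hu) _ ?_
      have h4 : (X : End F V) ^ 2 - 1 = x * (x - y) := by rw [mul_sub, hxy, sq]; rfl
      rw [h4, End.mul_apply, h1, map_zero]
    have h4 : a v = v := by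
      simp only [T, LinearMap.add_apply, LinearMap.sub_apply (f := 1), End.mul_apply, h3, map_zero,
        add_zero, End.one_apply] at hv
      exact (sub_eq_zero.1 hv).symm
    have h5 : P v = (n : F) • v := by
      have h6 : ∀ i, (a ^ i) v = v := fun i ↦ by
        induction i with
        | zero => rfl
        | succ i ih => rw [pow_succ, End.mul_apply, h4, ih]
      simp only [P, LinearMap.sum_apply, h6, Finset.sum_const, Finset.card_range,
        Nat.cast_smul_eq_nsmul]
    rw [h3] at h5
    exact (smul_eq_zero.1 h5.symm).resolve_left hN
  have hdetT : LinearMap.det T ≠ 0 := by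
    have := (LinearMap.isUnit_iff_ker_eq_bot T).2 (LinearMap.ker_eq_bot'.2 hTinj)
    exact (this.map LinearMap.det).ne_zero
  have hdet : LinearMap.det (toEnd h⁻¹) = 1 := by
    -- `T` and its adjoint `T * h⁻¹` have the same non-zero determinant.
    have h1 := det_eq_of_adjoint (σ := RingHom.id F) hQ.2 hadjT
    rw [hTb, map_mul, RingHom.id_apply] at h1
    exact (mul_eq_left₀ hdetT).1 h1
  have h1 : LinearMap.det (toEnd h * toEnd h⁻¹) = 1 := by
    rw [← map_mul, mul_inv_cancel, map_one, map_one]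
  rwa [map_mul, hdet, mul_one] at h1

/-- An odd power of `g` has `2`-power order, and taking it preserves a determinant `±1`. -/
theorem det_eq_one_of_commute [Finite F] (h2 : (2 : F) ≠ 0) (hQ : Q.polarBilin.Nondegenerate)
    {X g : V ≃ₗ[F] V} (hX : X ∈ orthogonalGroup Q) (hg : g ∈ orthogonalGroup Q)
    (hu : IsUnit ((X : End F V) ^ 2 - 1 : End F V)) (hc : Commute g X) :
    LinearEquiv.det g = 1 := by
  have : Finite V := Module.finite_of_finite F
  have : Finite (V ≃ₗ[F] V) := DFunLike.finite _
  obtain ⟨k, m, hm, hkm⟩ := Nat.exists_eq_two_pow_mul_odd (orderOf_pos g).ne'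
  have hpow : (g ^ m) ^ 2 ^ (k + 1) = 1 := by
    rw [← pow_mul, pow_succ, ← mul_assoc, mul_comm m, ← hkm, pow_mul, pow_orderOf_eq_one, one_pow]
  have h1 : LinearEquiv.det (g ^ m) = 1 := by
    refine Units.ext ?_
    rw [LinearEquiv.coe_det]
    exact det_eq_one_of_pow_two_pow h2 hQ hX ((orthogonalGroup Q).pow_mem hg m) hu (hc.pow_left m)
      hpow
  refine (det_eq_one_or_neg_one hQ hg).resolve_right fun h ↦ h2 ?_
  rw [map_pow, h, hm.neg_one_pow] at h1
  have h3 : (-1 : F) = 1 := by simpa using congrArg Units.val h1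
  linear_combination -h3

theorem conjClass_special_orthogonalGroup_of_not_isUnit (hQ : Q.polarBilin.Nondegenerate)
    {X : V ≃ₗ[F] V} (hX : X ∈ orthogonalGroup Q) (hss : IsSemisimple (X : End F V))
    (h : ¬ IsUnit ((X : End F V) ^ 2 - 1 : End F V)) :
    conjClass (special (orthogonalGroup Q)) X = conjClass (orthogonalGroup Q) X := by
  refine conjClass_special_eq fun g hg ↦ ?_
  rcases det_eq_one_or_neg_one hQ hg with hdet | hdet
  · exact ⟨1, one_mem _, Commute.one_left _, by rw [map_one, hdet]⟩
  · rw [hdet]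
    exact exists_commute_det_eq_neg_one hQ hX hss h

theorem conjClass_orthogonalGroup_eq_union (hQ : Q.polarBilin.Nondegenerate) {X Z : V ≃ₗ[F] V}
    (hZ : Z ∈ orthogonalGroup Q) (hdet : LinearEquiv.det Z = -1) :
    conjClass (orthogonalGroup Q) X = conjClass (special (orthogonalGroup Q)) X ∪
      conjClass (special (orthogonalGroup Q)) (Z⁻¹ * X * Z) := by
  ext Y
  constructor
  · rintro ⟨g, hg, rfl⟩
    rcases det_eq_one_or_neg_one hQ hg with h | h
    · exact .inl ⟨g, ⟨hg, h⟩, rfl⟩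
    · refine .inr ⟨Z⁻¹ * g, ⟨(orthogonalGroup Q).mul_mem ((orthogonalGroup Q).inv_mem hZ) hg, ?_⟩,
        by group⟩
      change LinearEquiv.det (Z⁻¹ * g) = 1
      rw [map_mul, map_inv, hdet, h, inv_mul_cancel]
  · rintro (⟨g, hg, rfl⟩ | ⟨g, hg, rfl⟩)
    · exact ⟨g, hg.1, rfl⟩
    · exact ⟨Z * g, mul_mem hZ hg.1, by group⟩

theorem disjoint_conjClass_special [Finite F] (h2 : (2 : F) ≠ 0)
    (hQ : Q.polarBilin.Nondegenerate) {X Z : V ≃ₗ[F] V} (hX : X ∈ orthogonalGroup Q)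
    (hu : IsUnit ((X : End F V) ^ 2 - 1 : End F V))
    (hZ : Z ∈ orthogonalGroup Q) (hdet : LinearEquiv.det Z = -1) :
    Disjoint (conjClass (special (orthogonalGroup Q)) X)
      (conjClass (special (orthogonalGroup Q)) (Z⁻¹ * X * Z)) := by
  rw [Set.disjoint_left]
  rintro _ ⟨g, hg, rfl⟩ ⟨k, hk, h⟩
  have hgO : g ∈ orthogonalGroup Q := hg.1
  have hg1 : LinearEquiv.det g = 1 := hg.2
  have hk1 : LinearEquiv.det k = 1 := hk.2
  -- A common element of the two classes yields a centralizing isometry of determinant `-1`.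
  have hc : Commute (Z * k * g⁻¹) X := by
    calc Z * k * g⁻¹ * X = Z * k * (g⁻¹ * X * g) * g⁻¹ := by group
      _ = Z * k * (k⁻¹ * (Z⁻¹ * X * Z) * k) * g⁻¹ := by rw [h]
      _ = X * (Z * k * g⁻¹) := by group
  have h1 := det_eq_one_of_commute h2 hQ hX (mul_mem (mul_mem hZ hk.1) (inv_mem hgO)) hu hc
  rw [map_mul, map_mul, map_inv, hdet, hg1, hk1, inv_one, mul_one, mul_one] at h1
  have h3 : (-1 : F) = 1 := by simpa using congrArg Units.val h1
  exact h2 (by linear_combination -h3)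

end Orthogonal

end ClassicalGroups
theorem mainTheorem4 {F V : Type*} [Field F] [Finite F] [AddCommGroup V] [Module F V]
    [FiniteDimensional F V] [Nontrivial V] :
    -- the unitary case
    (∀ (q : ℕ) (hq : Nat.card F = q ^ 2) (β : V →ₛₗ[bar hq] V →ₗ[F] F),
      β.IsSymm → β.Nondegenerate →
        (∀ X ∈ special (unitaryGroup β), IsSemisimpleElement X →
          conjClass (special (unitaryGroup β)) X = conjClass (unitaryGroup β) X) ∧
        (∀ X ∈ special (unitaryGroup β), ∀ Y ∈ special (unitaryGroup β),
          IsSemisimpleElement X → IsSemisimpleElement Y →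
            (Y ∈ conjClass (special (unitaryGroup β)) X ↔ Y ∈ conjClass (unitaryGroup β) X))) ∧
    -- the orthogonal case, odd characteristic
    (Odd (Nat.card F) → ∀ Q : QuadraticForm F V, Q.polarBilin.Nondegenerate →
      ∀ X ∈ special (orthogonalGroup Q), IsSemisimpleElement X →
        (¬ IsUnit ((X : Module.End F V) ^ 2 - 1 : Module.End F V) →
          conjClass (special (orthogonalGroup Q)) X = conjClass (orthogonalGroup Q) X) ∧
        (IsUnit ((X : Module.End F V) ^ 2 - 1 : Module.End F V) →
          (∃ Z ∈ orthogonalGroup Q, LinearEquiv.det Z = -1) ∧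
          ∀ Z ∈ orthogonalGroup Q, LinearEquiv.det Z = -1 →
            Z⁻¹ * X * Z ∈ special (orthogonalGroup Q) ∧
            Disjoint (conjClass (special (orthogonalGroup Q)) X)
              (conjClass (special (orthogonalGroup Q)) (Z⁻¹ * X * Z)) ∧
            conjClass (orthogonalGroup Q) X =
              conjClass (special (orthogonalGroup Q)) X ∪
                conjClass (special (orthogonalGroup Q)) (Z⁻¹ * X * Z))) := by
  refine ⟨fun q hq β hs hβ ↦ ⟨fun X hX hss ↦ ?_, fun X hX Y _ hss _ ↦ ?_⟩,
    fun hodd Q hQ X hX hss ↦ ⟨fun h ↦ ?_, fun hu ↦ ⟨exists_det_eq_neg_one hQ, fun Z hZ hdet ↦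
      ⟨?_, ?_, conjClass_orthogonalGroup_eq_union hQ hZ hdet⟩⟩⟩⟩
  · exact conjClass_special_unitaryGroup hq hs hβ hX.1 hss
  · rw [conjClass_special_unitaryGroup hq hs hβ hX.1 hss]
  · exact conjClass_special_orthogonalGroup_of_not_isUnit hQ hX.1
      (isSemisimple_of_isSemisimpleElement hss) h
  · refine ⟨(orthogonalGroup Q).mul_mem ((orthogonalGroup Q).mul_mem
      ((orthogonalGroup Q).inv_mem hZ) hX.1) hZ, ?_⟩
    change LinearEquiv.det (Z⁻¹ * X * Z) = 1
    have hX1 : LinearEquiv.det X = 1 := hX.2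
    rw [map_mul, map_mul, hX1, map_inv, mul_one, inv_mul_cancel]
  · refine disjoint_conjClass_special (fun h2 ↦ ?_) hQ hX.1 hu hZ hdet
    have := Fintype.ofFinite F
    rw [Nat.card_eq_fintype_card, Nat.odd_iff] at hodd
    have hchar : ringChar F ≠ 2 := fun h ↦ by
      have := FiniteField.even_card_of_char_two h
      omega
    exact Ring.two_ne_zero hchar h2
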